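/- Let $0<\alpha\le 1$, $L>0$, let $C,\mu,\rho>0$ be constants and let $k(t)>0$ for $t>0$. For $f\in C^1[0,L]$ let ${}^{C}D^{\alpha}_x f$ denote the Caputo derivative on $[0,L]$ with base point $0$, i.e. ${}^{C}D^{1}_xf=f'$ and ${}^{C}D^{\alpha}_xf(x)=\frac1{\Gamma(1-\alpha)}\int_0^x(x-y)^{-\alpha}f'(y)\,dy$ for $\alpha<1$. Consider the system $$\begin{cases}\dfrac{\partial P(x,t)}{\partial t}-\dfrac1C\dfrac{k(t)}{\mu}\dfrac{\partial}{\partial x}\,{}^{C}D^{\alpha}_xP(x,t)=\dfrac1{C\rho}Q(x,t), & t>0,\ x\in[0,L],\\[2mm] P(x,0)=g_0(x), & x\in[0,L],\\ P_x(0,t)=0,\qquad P(L,t)=u(t), & t>0.\end{cases}\tag{1}$$ A solution of (1) is a function $P:[0,L]\times[0,\infty)\to\mathbb R$ such that $\partial P/\partial t$ exists and is continuous on $[0,L]\times(0,\infty)$; for every $t>0$, $P(\cdot,t)\in C^1[0,L]$ and ${}^{C}D^{\alpha}_xP(\cdot,t)$ is absolutely continuous on $[0,L]$; for every $t>0$ the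 differential equation holds for almost every $x\in[0,L]$; the initial and boundary conditions hold pointwise; and $\int_0^L|P(x,t)-g_0(x)|\,dx\to0$ as $t\to0^+$. **Theorem (Uniqueness).** Let $g_0\in L^1(0,L)$ and $u\in C^1([0,\infty))$. Let $P_1$ and $P_2$ be solutions of (1), with the same $g_0$ and $u$, for the source terms $Q_1$ and $Q_2$ respectively, where $Q_1(\cdot,t),Q_2(\cdot,t)\in L^1(0,L)$ for every $t>0$. If $Q_1(\cdot,t)=Q_2(\cdot,t)$ almost everywhere on $[0,L]$ for every $t>0$, then $P_1(x,t)=P_2(x,t)$ for all $x\in[0,L]$ and $t\ge0$. -/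

import Mathlib

open Set Filter Topology MeasureTheory

noncomputable section

/-- The (left-sided) Caputo derivative of order `α` with base point `a`, at the point `x ∈ [a, b]`,
of a function `f` of class `C^n` on `[a, b]`, where `n = ⌈α⌉`, i.e. `n - 1 < α ≤ n`:
it is `f^(n)(x)` if `α = n`, and otherwise
`(1 / Γ(n - α)) ∫_a^x (x - τ)^(n - α - 1) f^(n)(τ) dτ`. -/
def caputoDeriv (α a b : ℝ) (f : ℝ → ℝ) (x : ℝ) : ℝ :=
  if α = (⌈α⌉₊ : ℝ) then iteratedDerivWithin ⌈α⌉₊ f (Icc a b) x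
  else 1 / Real.Gamma ((⌈α⌉₊ : ℝ) - α) *
    ∫ τ in a..x, (x - τ) ^ ((⌈α⌉₊ : ℝ) - α - 1) * iteratedDerivWithin ⌈α⌉₊ f (Icc a b) τ

/-- `P = P(x, t)` solves, on `[0, L] × [0, ∞)`, the space-fractional gas pressure system

* `∂P/∂t - (1 / C) (k(t) / μ) ∂/∂x (ᶜD^α_x P) = (1 / (C ρ)) Q(x, t)`,
* `P(x, 0) = g₀(x)`,
* `P_x(0, t) = 0`, `P(L, t) = u(t)` for `t > 0`.

For every `t > 0` the profile `P(·, t)` is `C¹` on `[0, L]` and its Caputo derivative is absolutely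
continuous, so that the equation makes sense for almost every `x`, as it should when `Q(·, t)` is
only known to be in `L¹`. -/
structure IsGasPressureSolution (α L C μ ρ : ℝ) (k u g₀ : ℝ → ℝ) (Q P : ℝ → ℝ → ℝ) : Prop where
  /-- `P(·, t)` is `C¹` on `[0, L]`. -/
  contDiffOn_space : ∀ t > 0, ContDiffOn ℝ 1 (fun x => P x t) (Icc 0 L)
  /-- `ᶜD^α_x P(·, t)` is absolutely continuous on `[0, L]`. -/
  absolutelyContinuous_caputo : ∀ t > 0,
    AbsolutelyContinuousOnInterval (caputoDeriv α 0 L (fun x => P x t)) 0 L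
  /-- `∂P/∂t` exists on `[0, L] × (0, ∞)`. -/
  differentiableAt_time : ∀ x ∈ Icc 0 L, ∀ t > 0, DifferentiableAt ℝ (fun s => P x s) t
  /-- `∂P/∂t` is continuous on `[0, L] × (0, ∞)`. -/
  continuousOn_deriv_time :
    ContinuousOn (fun p : ℝ × ℝ => deriv (fun s => P p.1 s) p.2) (Icc 0 L ×ˢ Ioi 0)
  /-- The equation. -/
  equation : ∀ t > 0, ∀ᵐ x ∂(volume.restrict (Icc 0 L)),
    deriv (fun s => P x s) t
      - 1 / C * (k t / μ) * deriv (caputoDeriv α 0 L (fun y => P y t)) x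
      = 1 / (C * ρ) * Q x t
  /-- The initial condition `P(x, 0) = g₀(x)`. -/
  initial : ∀ x ∈ Icc 0 L, P x 0 = g₀ x
  /-- The initial value is attained continuously in `L¹(0, L)`. -/
  initial_tendsto : Tendsto (fun t => ∫ x in (0 : ℝ)..L, |P x t - g₀ x|) (𝓝[>] 0) (𝓝 0)
  /-- The boundary condition at `x = 0`. -/
  boundary_left : ∀ t > 0, HasDerivWithinAt (fun x => P x t) 0 (Icc 0 L) 0
  /-- The boundary condition at `x = L`. -/
  boundary_right : ∀ t > 0, P L t = u t

end

/-!
Write `D = P₁ - P₂`. Subtracting the equations gives `∂ₜD = a(t) A D` with `a(t) = k(t) / (C μ) > 0`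
and `A = ∂ₓ ᶜD^α`, the boundary conditions `∂ₓD(0, t) = 0`, `D(L, t) = 0`, and `D(·, t) → 0` in
`L¹` as `t → 0`. An energy estimate for `∫ D²` alone is not enough, since the initial value is only
attained in `L¹`. The remedy is to apply the inverse of `A`, which is explicit: up to a positive
constant it is the integral operator `G` with the bounded kernel
`greenKernel α L x y = (x - y)₊ ^ α - (L - y) ^ α`, and it maps `L¹` boundedly into `L^∞`.

* Inverting `A` is Abel's argument: `I^α I^{1-α} = I^1`
  (`beta_mul_integral_eq_of_abel`, `exists_sub_eq_of_caputoDeriv_sub_eq`). It turns the equation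
  into `c(t) D = G ∂ₜD` with some `c(t) > 0`. Hence `V = G D` satisfies `∂ₜV = c D`, without any
  regularity of `k`.
* `G` is dissipative: `∫ D (G D) ≤ 0` (`rpowKernel_quadratic_nonpos`). For `α < 1` the function
  `z ^ α` is a mixture with positive weights of the functions `1 - exp (-s z)`, `s > 0`, and for
  each of these the quadratic form is minus a sum of squares
  (`expKernel_quadratic_nonpos`); for `α = 1` it is `-∫ (∫_0^x D)² dx`.
* Therefore `∫ V²` is nonincreasing in `t > 0`. It tends to `0` as `t → 0` because `|V|` is bounded
  by `L ^ α ∫ |D|`, so `V = 0`, and then `c D = ∂ₜV = 0`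
  (`eq_zero_of_integrated_equation`).
-/

/-! ### Dissipativity of the kernel `(x - y)₊ ^ α - (L - y) ^ α` -/

/-- The value at `x` is `w L - w x - F L + F x`, where `w x = ∫_0^x exp (-s (x - y)) P y dy` and
`F x = ∫_0^x P`. -/
lemma integral_expKernel {P : ℝ → ℝ} (hP : Continuous P) {L x : ℝ} (hx : x ∈ Icc 0 L) (s : ℝ) :
    ∫ y in (0 : ℝ)..L, (Real.exp (-s * (L - y)) - Real.exp (-s * max (x - y) 0)) * P y
      = (Real.exp (-s * L) * ∫ y in (0 : ℝ)..L, Real.exp (s * y) * P y)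
        - (Real.exp (-s * x) * ∫ y in (0 : ℝ)..x, Real.exp (s * y) * P y)
        - (∫ y in (0 : ℝ)..L, P y) + ∫ y in (0 : ℝ)..x, P y := by
  have hint : ∀ {f : ℝ → ℝ} (_ : Continuous f) (a b : ℝ), IntervalIntegrable f volume a b :=
    fun hf a b => hf.intervalIntegrable a b
  have h1 : ∫ y in (0 : ℝ)..L, Real.exp (-s * (L - y)) * P y
      = Real.exp (-s * L) * ∫ y in (0 : ℝ)..L, Real.exp (s * y) * P y := by
    rw [← intervalIntegral.integral_const_mul]
    refine intervalIntegral.integral_congr fun y _ => ?_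
    simp only [← mul_assoc, ← Real.exp_add]; ring_nf
  have h2 : ∫ y in (0 : ℝ)..x, Real.exp (-s * max (x - y) 0) * P y
      = Real.exp (-s * x) * ∫ y in (0 : ℝ)..x, Real.exp (s * y) * P y := by
    rw [← intervalIntegral.integral_const_mul]
    refine intervalIntegral.integral_congr fun y hy => ?_
    rw [uIcc_of_le hx.1] at hy
    simp only [← mul_assoc, ← Real.exp_add]
    rw [max_eq_left (by linarith [hy.2])]; ring_nf
  have h3 : ∫ y in x..L, Real.exp (-s * max (x - y) 0) * P y = ∫ y in x..L, P y := by
    refine intervalIntegral.integral_congr fun y hy => ?_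
    rw [uIcc_of_le hx.2] at hy
    rw [max_eq_right (by linarith [hy.1])]; simp
  have h4 := intervalIntegral.integral_add_adjacent_intervals
    (hint (f := fun y => Real.exp (-s * max (x - y) 0) * P y) (by fun_prop) 0 x)
    (hint (f := fun y => Real.exp (-s * max (x - y) 0) * P y) (by fun_prop) x L)
  have h5 := intervalIntegral.integral_add_adjacent_intervals (hint hP 0 x) (hint hP x L)
  simp only [sub_mul]
  rw [intervalIntegral.integral_sub (hint (by fun_prop) _ _) (hint (by fun_prop) _ _), h1, ← h4,
    h2, h3, ← h5]
  ring

/-- With `w x = ∫_0^x exp (-s (x - y)) P y dy`, so that `w' = P - s w`, and `F x = ∫_0^x P`, the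
quadratic form equals `- (F L - w L)² / 2 - s ∫ w²`. -/
lemma expKernel_quadratic_nonpos {P : ℝ → ℝ} (hP : Continuous P) {L : ℝ} (hL : 0 ≤ L)
    {s : ℝ} (hs : 0 ≤ s) :
    ∫ x in (0 : ℝ)..L, P x *
      ∫ y in (0 : ℝ)..L, (Real.exp (-s * (L - y)) - Real.exp (-s * max (x - y) 0)) * P y ≤ 0 := by
  set F : ℝ → ℝ := fun x => ∫ y in (0 : ℝ)..x, P y with hF
  set w : ℝ → ℝ := fun x => Real.exp (-s * x) * ∫ y in (0 : ℝ)..x, Real.exp (s * y) * P y with hw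
  have hF' : ∀ x, HasDerivAt F (P x) x := fun x =>
    intervalIntegral.integral_hasDerivAt_right (hP.intervalIntegrable _ _)
      (hP.stronglyMeasurableAtFilter _ _) hP.continuousAt
  have hw' : ∀ x, HasDerivAt w (P x - s * w x) x := fun x => by
    have hc : Continuous fun y => Real.exp (s * y) * P y := by fun_prop
    have h1 := intervalIntegral.integral_hasDerivAt_right (hc.intervalIntegrable 0 x)
      (hc.stronglyMeasurableAtFilter _ _) hc.continuousAt
    have h2 : HasDerivAt (fun x : ℝ => Real.exp (-s * x)) (Real.exp (-s * x) * (-s)) x := by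
      simpa using ((hasDerivAt_id x).const_mul (-s)).exp
    refine (h2.mul h1).congr_deriv ?_
    have : Real.exp (-s * x) * Real.exp (s * x) = 1 := by rw [← Real.exp_add]; simp
    simp only [hw]
    linear_combination P x * this
  have hFc : Continuous F := continuous_iff_continuousAt.2 fun x => (hF' x).continuousAt
  have hwc : Continuous w := continuous_iff_continuousAt.2 fun x => (hw' x).continuousAt
  have hcongr : ∫ x in (0 : ℝ)..L, P x *
      ∫ y in (0 : ℝ)..L, (Real.exp (-s * (L - y)) - Real.exp (-s * max (x - y) 0)) * P y
      = ∫ x in (0 : ℝ)..L, (F x * P x - w x * (P x - s * w x) - (F L - w L) * P x)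
          - s * (w x) ^ 2 := by
    refine intervalIntegral.integral_congr fun x hx => ?_
    rw [uIcc_of_le hL] at hx
    rw [integral_expKernel hP hx s]
    simp only [hF, hw]
    ring
  -- `P = F'` and `w P = w w' + s w²`, so all but the last term has an explicit primitive.
  have hprim : ∀ x, HasDerivAt (fun x => F x ^ 2 / 2 - w x ^ 2 / 2 - (F L - w L) * F x)
      (F x * P x - w x * (P x - s * w x) - (F L - w L) * P x) x := fun x => by
    refine (((((hF' x).pow 2).div_const 2).sub (((hw' x).pow 2).div_const 2)).sub
      ((hF' x).const_mul (F L - w L))).congr_deriv ?_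
    simp only [Nat.cast_ofNat]; ring
  have hFTC := intervalIntegral.integral_eq_sub_of_hasDerivAt (a := 0) (b := L)
    (fun x _ => hprim x) (Continuous.intervalIntegrable (by fun_prop) _ _)
  have hF0 : F 0 = 0 := by simp [hF]
  have hw0 : w 0 = 0 := by simp [hw]
  have hsq : 0 ≤ ∫ x in (0 : ℝ)..L, s * (w x) ^ 2 :=
    intervalIntegral.integral_nonneg hL fun x _ => by positivity
  rw [hcongr, intervalIntegral.integral_sub (Continuous.intervalIntegrable (by fun_prop) _ _)
    (Continuous.intervalIntegrable (by fun_prop) _ _), hFTC, hF0, hw0]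
  nlinarith [sq_nonneg (F L - w L)]

lemma integrableOn_one_sub_exp_mul_rpow {α : ℝ} (hα₀ : 0 < α) (hα₁ : α < 1) {z : ℝ} (hz : 0 ≤ z) :
    IntegrableOn (fun s : ℝ => (1 - Real.exp (-s * z)) * s ^ (-1 - α)) (Ioi 0) := by
  rw [← Ioc_union_Ioi_eq_Ioi zero_le_one]
  have hm : Measurable fun s : ℝ => (1 - Real.exp (-s * z)) * s ^ (-1 - α) := by fun_prop
  refine IntegrableOn.union ?_ ?_
  · have h : IntegrableOn (fun s : ℝ => z * s ^ (-α)) (Ioc 0 1) :=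
      ((intervalIntegrable_iff_integrableOn_Ioc_of_le zero_le_one).1
        (intervalIntegral.intervalIntegrable_rpow' (by linarith))).const_mul z
    refine h.mono' hm.aestronglyMeasurable ?_
    filter_upwards [ae_restrict_mem measurableSet_Ioc] with s hs
    have h1 : Real.exp (-s * z) ≤ 1 := Real.exp_le_one_iff.2 (by nlinarith [hs.1])
    have h2 : 1 - Real.exp (-s * z) ≤ s * z := by linarith [Real.add_one_le_exp (-s * z)]
    have h3 : 0 ≤ s ^ (-1 - α) := Real.rpow_nonneg hs.1.le _
    rw [Real.norm_eq_abs, abs_of_nonneg (mul_nonneg (by linarith) h3)]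
    calc _ ≤ s * z * s ^ (-1 - α) := by gcongr
      _ = z * (s ^ (1 : ℝ) * s ^ (-1 - α)) := by rw [Real.rpow_one]; ring
      _ = _ := by rw [← Real.rpow_add hs.1]; ring_nf
  · have h : IntegrableOn (fun s : ℝ => s ^ (-1 - α)) (Ioi 1) :=
      integrableOn_Ioi_rpow_of_lt (by linarith) zero_lt_one
    refine h.mono' hm.aestronglyMeasurable ?_
    filter_upwards [ae_restrict_mem measurableSet_Ioi] with s hs
    have hs0 : (0 : ℝ) < s := zero_lt_one.trans hs
    have h1 : Real.exp (-s * z) ≤ 1 := Real.exp_le_one_iff.2 (by nlinarith)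
    have h3 : 0 ≤ s ^ (-1 - α) := Real.rpow_nonneg hs0.le _
    rw [Real.norm_eq_abs, abs_of_nonneg (mul_nonneg (by linarith) h3)]
    nlinarith [Real.exp_pos (-s * z)]

/-- `z ^ α` is, up to a positive constant, a mixture of the Bernstein functions
`1 - exp (-s z)`. -/
lemma exists_rpow_eq_integral_one_sub_exp {α : ℝ} (hα₀ : 0 < α) (hα₁ : α < 1) :
    ∃ c > 0, ∀ z, 0 ≤ z →
      ∫ s in Ioi (0 : ℝ), (1 - Real.exp (-s * z)) * s ^ (-1 - α) = c * z ^ α := by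
  refine ⟨∫ s in Ioi (0 : ℝ), (1 - Real.exp (-s * 1)) * s ^ (-1 - α), ?_, fun z hz => ?_⟩
  · rw [gt_iff_lt, setIntegral_pos_iff_support_of_nonneg_ae]
    · have : Ioi (0 : ℝ) ⊆
          Function.support (fun s : ℝ => (1 - Real.exp (-s * 1)) * s ^ (-1 - α)) := fun s hs => by
        have h1 : Real.exp (-s * 1) < 1 := Real.exp_lt_one_iff.2 (by simpa using hs)
        exact (mul_pos (by linarith) (Real.rpow_pos_of_pos hs _)).ne'
      rw [inter_eq_right.2 this]; simp
    · filter_upwards [ae_restrict_mem measurableSet_Ioi] with s hs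
      have h1 : Real.exp (-s * 1) ≤ 1 := Real.exp_le_one_iff.2 (by simpa using hs.le)
      exact mul_nonneg (by linarith) (Real.rpow_nonneg hs.le _)
    · exact integrableOn_one_sub_exp_mul_rpow hα₀ hα₁ zero_le_one
  · rcases hz.eq_or_lt with rfl | hz
    · simp [Real.zero_rpow hα₀.ne']
    · -- By the substitution `s ↦ z s` the integral is homogeneous of degree `α` in `z`.
      have h := integral_comp_mul_left_Ioi
        (fun s : ℝ => (1 - Real.exp (-s * 1)) * s ^ (-1 - α)) 0 hz
      rw [mul_zero, smul_eq_mul] at h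
      have h2 : ∫ s in Ioi (0 : ℝ), (1 - Real.exp (-(z * s) * 1)) * (z * s) ^ (-1 - α)
          = z ^ (-1 - α) * ∫ s in Ioi (0 : ℝ), (1 - Real.exp (-s * z)) * s ^ (-1 - α) := by
        rw [← integral_const_mul]
        refine setIntegral_congr_fun measurableSet_Ioi fun s hs => ?_
        rw [Real.mul_rpow hz.le (le_of_lt hs)]; ring_nf
      rw [h2] at h
      have h3 : z ^ (-1 - α) * (z * z ^ α) = 1 := by
        nth_rw 2 [← Real.rpow_one z]
        rw [← Real.rpow_add hz, ← Real.rpow_add hz]; ring_nf; simp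
      have h4 : z * z⁻¹ = 1 := mul_inv_cancel₀ hz.ne'
      set I := ∫ s in Ioi (0 : ℝ), (1 - Real.exp (-s * z)) * s ^ (-1 - α)
      set J := ∫ s in Ioi (0 : ℝ), (1 - Real.exp (-s * 1)) * s ^ (-1 - α)
      linear_combination (-I) * h3 + z * z ^ α * h + J * z ^ α * h4

lemma rpowKernel_quadratic_nonpos_of_lt_one {α : ℝ} (hα₀ : 0 < α) (hα₁ : α < 1) {L : ℝ}
    (hL : 0 ≤ L) {P : ℝ → ℝ} (hP : Continuous P) :
    ∫ x in (0 : ℝ)..L, P x * ∫ y in (0 : ℝ)..L, (max (x - y) 0 ^ α - (L - y) ^ α) * P y ≤ 0 := by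
  obtain ⟨c, hc, hrep⟩ := exists_rpow_eq_integral_one_sub_exp hα₀ hα₁
  obtain ⟨M, hM⟩ := (isCompact_Icc (a := 0) (b := L)).exists_bound_of_continuousOn hP.continuousOn
  have hM0 : 0 ≤ M := (norm_nonneg _).trans (hM 0 ⟨le_rfl, hL⟩)
  set m : Measure ℝ := volume.restrict (Ioc 0 L) with hm
  set ν : Measure ℝ := volume.restrict (Ioi 0) with hν
  -- Fubini for the integrand `H` exchanges the quadratic form with the mixture over `s`.
  let H : (ℝ × ℝ) → ℝ → ℝ := fun p s =>
    (Real.exp (-s * (L - p.2)) - Real.exp (-s * max (p.1 - p.2) 0)) * s ^ (-1 - α)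
      * (P p.1 * P p.2)
  have hmem : ∀ᵐ p ∂(m.prod m), p ∈ Ioc 0 L ×ˢ Ioc 0 L := by
    rw [hm, Measure.prod_restrict]
    exact ae_restrict_mem (measurableSet_Ioc.prod measurableSet_Ioc)
  have hH : Integrable (Function.uncurry H) ((m.prod m).prod ν) := by
    have hdom : Integrable (fun q : (ℝ × ℝ) × ℝ =>
        (M * M) * ((1 - Real.exp (-q.2 * L)) * q.2 ^ (-1 - α))) ((m.prod m).prod ν) :=
      (integrable_const (M * M)).mul_prod (integrableOn_one_sub_exp_mul_rpow hα₀ hα₁ hL)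
    have hmeas : Measurable (Function.uncurry H) := by
      have := hP.measurable
      simp only [H, Function.uncurry_def]
      fun_prop
    refine hdom.mono' hmeas.aestronglyMeasurable ?_
    have h1 : ∀ᵐ q ∂((m.prod m).prod ν), q.1 ∈ Ioc 0 L ×ˢ Ioc 0 L :=
      Measure.quasiMeasurePreserving_fst.ae hmem
    have h2 : ∀ᵐ q ∂((m.prod m).prod ν), q.2 ∈ Ioi (0 : ℝ) :=
      Measure.quasiMeasurePreserving_snd.ae (ae_restrict_mem measurableSet_Ioi)
    filter_upwards [h1, h2] with q hq hs
    obtain ⟨⟨x, y⟩, s⟩ := q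
    obtain ⟨⟨hx0, hxL⟩, hy0, hyL⟩ := hq
    simp only [mem_Ioi] at hs hx0 hxL hy0 hyL
    simp only [H, Function.uncurry_def, norm_mul]
    have hs' : 0 ≤ s ^ (-1 - α) := Real.rpow_nonneg hs.le _
    have hPx := hM x ⟨hx0.le, hxL⟩
    have hPy := hM y ⟨hy0.le, hyL⟩
    have hb : ∀ z, 0 ≤ z → z ≤ L →
        Real.exp (-s * L) ≤ Real.exp (-s * z) ∧ Real.exp (-s * z) ≤ 1 := fun z h0 h1 =>
      ⟨Real.exp_le_exp.2 (by nlinarith), Real.exp_le_one_iff.2 (by nlinarith)⟩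
    obtain ⟨ha1, ha2⟩ := hb (L - y) (by linarith) (by linarith)
    obtain ⟨hb1, hb2⟩ := hb (max (x - y) 0) (le_max_right _ _) (max_le (by linarith) hL)
    have hK : ‖Real.exp (-s * (L - y)) - Real.exp (-s * max (x - y) 0)‖
        ≤ 1 - Real.exp (-s * L) := by
      rw [Real.norm_eq_abs, abs_le]; constructor <;> linarith
    rw [Real.norm_of_nonneg hs', mul_comm (M * M)]
    have := (norm_nonneg _).trans hK
    gcongr
  have hswap := integral_integral_swap hH
  have hleft : ∫ p, ∫ s, H p s ∂ν ∂(m.prod m)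
      = c * ∫ x in (0 : ℝ)..L, P x *
        ∫ y in (0 : ℝ)..L, (max (x - y) 0 ^ α - (L - y) ^ α) * P y := by
    have hint : Integrable (fun p => ∫ s, H p s ∂ν) (m.prod m) := hH.integral_prod_left
    rw [integral_prod _ hint, intervalIntegral.integral_of_le hL, ← integral_const_mul]
    refine integral_congr_ae ?_
    filter_upwards [ae_restrict_mem measurableSet_Ioc] with x hx
    rw [intervalIntegral.integral_of_le hL, ← mul_assoc, ← integral_const_mul]
    refine integral_congr_ae ?_
    filter_upwards [ae_restrict_mem measurableSet_Ioc] with y hy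
    have hLy : 0 ≤ L - y := by linarith [hy.2]
    have h1 := hrep _ (le_max_right (x - y) 0)
    have h2 := hrep _ hLy
    have h3 := integral_sub
      (integrableOn_one_sub_exp_mul_rpow hα₀ hα₁ (le_max_right (x - y) 0))
      (integrableOn_one_sub_exp_mul_rpow hα₀ hα₁ hLy)
    rw [h1, h2] at h3
    calc ∫ s, H (x, y) s ∂ν
        = ∫ s in Ioi (0 : ℝ), ((1 - Real.exp (-s * max (x - y) 0)) * s ^ (-1 - α)
            - (1 - Real.exp (-s * (L - y))) * s ^ (-1 - α)) * (P x * P y) := by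
          refine integral_congr_ae (Eventually.of_forall fun s => ?_)
          simp only [H]; ring
      _ = _ := by rw [integral_mul_const, h3]; ring
  have hright : ∫ s, ∫ p, H p s ∂(m.prod m) ∂ν ≤ 0 := by
    refine integral_nonpos_of_ae ?_
    filter_upwards [ae_restrict_mem measurableSet_Ioi, hH.prod_left_ae] with s hs hint
    have hs0 : (0 : ℝ) < s := hs
    have h := mul_nonpos_of_nonneg_of_nonpos (Real.rpow_nonneg hs0.le (-1 - α))
      (expKernel_quadratic_nonpos hP hL hs0.le)
    refine le_of_eq_of_le ?_ h
    rw [integral_prod (fun p => H p s) hint, intervalIntegral.integral_of_le hL,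
      ← integral_const_mul]
    refine integral_congr_ae (Eventually.of_forall fun x => ?_)
    simp only
    rw [intervalIntegral.integral_of_le hL, ← mul_assoc, ← integral_const_mul]
    refine integral_congr_ae (Eventually.of_forall fun y => ?_)
    simp only [H]; ring
  rw [hswap] at hleft
  by_contra! hpos
  exact absurd hright (not_le.2 (hleft ▸ mul_pos hc hpos))

/-- In the limiting case of order one the quadratic form is `- ∫ F²`, where `F x = ∫_0^x P`. -/
lemma linearKernel_quadratic_nonpos {L : ℝ} (hL : 0 ≤ L) {P : ℝ → ℝ} (hP : Continuous P) :
    ∫ x in (0 : ℝ)..L, P x * ∫ y in (0 : ℝ)..L, (max (x - y) 0 - (L - y)) * P y ≤ 0 := by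
  set F : ℝ → ℝ := fun x => ∫ y in (0 : ℝ)..x, P y with hF
  set G : ℝ → ℝ := fun x => ∫ y in (0 : ℝ)..x, y * P y with hG
  have hint : ∀ {f : ℝ → ℝ} (_ : Continuous f) (a b : ℝ), IntervalIntegrable f volume a b :=
    fun hf a b => hf.intervalIntegrable a b
  have hderiv : ∀ {f : ℝ → ℝ} (_ : Continuous f) (x : ℝ),
      HasDerivAt (fun x => ∫ y in (0 : ℝ)..x, f y) (f x) x := fun hf x =>
    intervalIntegral.integral_hasDerivAt_right (hf.intervalIntegrable _ _)
      (hf.stronglyMeasurableAtFilter _ _) hf.continuousAt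
  have hF' : ∀ x, HasDerivAt F (P x) x := hderiv hP
  have hG' : ∀ x, HasDerivAt G (x * P x) x := hderiv (f := fun y => y * P y) (by fun_prop)
  have hFc : Continuous F := continuous_iff_continuousAt.2 fun x => (hF' x).continuousAt
  have hGc : Continuous G := continuous_iff_continuousAt.2 fun x => (hG' x).continuousAt
  have hV : ∀ x ∈ Icc 0 L, ∫ y in (0 : ℝ)..L, (max (x - y) 0 - (L - y)) * P y
      = (x * F x - G x) - (L * F L - G L) := fun x hx => by
    have h1 : ∀ z, ∫ y in (0 : ℝ)..z, (z - y) * P y = z * F z - G z := fun z => by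
      simp only [sub_mul]
      rw [intervalIntegral.integral_sub (hint (by fun_prop) _ _) (hint (by fun_prop) _ _),
        intervalIntegral.integral_const_mul]
    have h2 : ∫ y in (0 : ℝ)..x, max (x - y) 0 * P y = ∫ y in (0 : ℝ)..x, (x - y) * P y := by
      refine intervalIntegral.integral_congr fun y hy => ?_
      rw [uIcc_of_le hx.1] at hy
      rw [max_eq_left (by linarith [hy.2])]
    have h3 : ∫ y in x..L, max (x - y) 0 * P y = 0 := by
      rw [intervalIntegral.integral_congr (g := fun _ => 0), intervalIntegral.integral_zero]
      intro y hy
      rw [uIcc_of_le hx.2] at hy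
      simp only [max_eq_right (by linarith [hy.1] : x - y ≤ 0), zero_mul]
    have h4 := intervalIntegral.integral_add_adjacent_intervals
      (hint (f := fun y => max (x - y) 0 * P y) (by fun_prop) 0 x)
      (hint (f := fun y => max (x - y) 0 * P y) (by fun_prop) x L)
    simp only [sub_mul _ (L - _)]
    rw [intervalIntegral.integral_sub (hint (by fun_prop) _ _) (hint (by fun_prop) _ _), h1,
      ← h4, h2, h3, h1, add_zero]
  have hcongr : ∫ x in (0 : ℝ)..L, P x * ∫ y in (0 : ℝ)..L, (max (x - y) 0 - (L - y)) * P y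
      = ∫ x in (0 : ℝ)..L, ((P x * ((x * F x - G x) - (L * F L - G L)) + F x * F x)
          - F x ^ 2) := by
    refine intervalIntegral.integral_congr fun x hx => ?_
    rw [uIcc_of_le hL] at hx
    rw [hV x hx]; ring
  have hprim : ∀ x, HasDerivAt (fun x => F x * ((x * F x - G x) - (L * F L - G L)))
      (P x * ((x * F x - G x) - (L * F L - G L)) + F x * F x) x := fun x => by
    refine ((hF' x).mul ((((hasDerivAt_id x).mul (hF' x)).sub (hG' x)).sub_const
      (L * F L - G L))).congr_deriv ?_
    simp only [id, Pi.mul_apply, Pi.sub_apply]; ring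
  have hFTC := intervalIntegral.integral_eq_sub_of_hasDerivAt (a := 0) (b := L)
    (fun x _ => hprim x) (Continuous.intervalIntegrable (by fun_prop) _ _)
  have hF0 : F 0 = 0 := by simp [hF]
  have hsq : 0 ≤ ∫ x in (0 : ℝ)..L, F x ^ 2 :=
    intervalIntegral.integral_nonneg hL fun x _ => by positivity
  rw [hcongr, intervalIntegral.integral_sub (Continuous.intervalIntegrable (by fun_prop) _ _)
    (Continuous.intervalIntegrable (by fun_prop) _ _), hFTC, hF0]
  linarith

/-- The operator with kernel `max (x - y) 0 ^ α - (L - y) ^ α` is dissipative on `L²(0, L)`. -/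
lemma rpowKernel_quadratic_nonpos {α : ℝ} (hα₀ : 0 < α) (hα₁ : α ≤ 1) {L : ℝ}
    (hL : 0 ≤ L) {P : ℝ → ℝ} (hP : ContinuousOn P (Icc 0 L)) :
    ∫ x in (0 : ℝ)..L, P x * ∫ y in (0 : ℝ)..L, (max (x - y) 0 ^ α - (L - y) ^ α) * P y ≤ 0 := by
  have hext : ∀ x ∈ uIcc 0 L, IccExtend hL ((Icc 0 L).domRestrict P) x = P x := fun x hx => by
    rw [uIcc_of_le hL] at hx
    rw [IccExtend_of_mem hL _ hx, domRestrict_apply]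
  have hcont : Continuous (IccExtend hL ((Icc 0 L).domRestrict P)) :=
    (continuousOn_iff_continuous_domRestrict.1 hP).Icc_extend'
  have key : ∫ x in (0 : ℝ)..L, IccExtend hL ((Icc 0 L).domRestrict P) x * ∫ y in (0 : ℝ)..L,
      (max (x - y) 0 ^ α - (L - y) ^ α) * IccExtend hL ((Icc 0 L).domRestrict P) y ≤ 0 := by
    rcases hα₁.eq_or_lt with rfl | hlt
    · simpa only [Real.rpow_one] using linearKernel_quadratic_nonpos hL hcont
    · exact rpowKernel_quadratic_nonpos_of_lt_one hα₀ hlt hL hcont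
  refine le_of_eq_of_le (intervalIntegral.integral_congr fun x hx => ?_) key
  rw [hext x hx]
  congr 1
  exact intervalIntegral.integral_congr fun y hy => by rw [hext y hy]

/-! ### Abel's integral equation -/

section Abel

open scoped Convolution

/-- Dirichlet's formula, i.e. associativity of convolution on a half-line, at the point `x`. -/
lemma integral_convolution_assoc {f g k : ℝ → ℝ} {x : ℝ} (hx : 0 ≤ x)
    (hf : ContinuousOn f (Icc 0 x)) (hg : IntervalIntegrable g volume 0 x)
    (hk : IntervalIntegrable k volume 0 x) :
    ∫ y in (0 : ℝ)..x, (∫ τ in (0 : ℝ)..y, f τ * g (y - τ)) * k (x - y)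
      = ∫ τ in (0 : ℝ)..x, f τ * ∫ u in (0 : ℝ)..(x - τ), g u * k (x - τ - u) := by
  -- Only values on the window `(0, x)` matter at `x`; truncating there makes all three functions
  -- integrable on the line, so that Mathlib's associativity of convolution applies.
  set I : Set ℝ := Ioo 0 x with hI
  have hIm : MeasurableSet I := measurableSet_Ioo
  obtain ⟨M, hM⟩ := isCompact_Icc.exists_bound_of_continuousOn hf
  have hM0 : 0 ≤ M := (norm_nonneg _).trans (hM 0 ⟨le_rfl, hx⟩)
  have hind : ∀ {p : ℝ → ℝ}, IntervalIntegrable p volume 0 x → Integrable (I.indicator p) :=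
    fun hp => (integrable_indicator_iff hIm).2
      (((intervalIntegrable_iff_integrableOn_Ioc_of_le hx).1 hp).mono_set Ioo_subset_Ioc_self)
  have hf' : Integrable (I.indicator f) := hind (hf.intervalIntegrable_of_Icc hx)
  have hg' := hind hg
  have hk' := hind hk
  have hconv : ∀ (p q : ℝ → ℝ) (y : ℝ), 0 ≤ y → y ≤ x →
      (I.indicator p ⋆[ContinuousLinearMap.mul ℝ ℝ] I.indicator q) y
        = ∫ τ in (0 : ℝ)..y, p τ * q (y - τ) := fun p q y hy hyx => by
    rw [convolution_def, intervalIntegral.integral_of_le hy, integral_Ioc_eq_integral_Ioo,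
      ← integral_indicator measurableSet_Ioo]
    refine integral_congr_ae (Eventually.of_forall fun τ => ?_)
    by_cases hτ : τ ∈ Ioo 0 y
    · have h1 : τ ∈ I := ⟨hτ.1, hτ.2.trans_le hyx⟩
      have h2 : y - τ ∈ I := ⟨by linarith [hτ.2], by linarith [hτ.1]⟩
      simp [hτ, h1, h2]
    · rw [indicator_of_notMem hτ]
      by_cases h1 : τ ∈ I
      · have h2 : y - τ ∉ I := fun h => hτ ⟨h1.1, by linarith [h.1]⟩
        simp [h2]
      · simp [h1]
  have hleft : ∀ (p q : ℝ → ℝ), (p ⋆[ContinuousLinearMap.mul ℝ ℝ] I.indicator q) x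
      = ∫ y in (0 : ℝ)..x, p y * q (x - y) := fun p q => by
    rw [convolution_def, intervalIntegral.integral_of_le hx, integral_Ioc_eq_integral_Ioo,
      ← integral_indicator measurableSet_Ioo]
    refine integral_congr_ae (Eventually.of_forall fun y => ?_)
    have hiff : x - y ∈ I ↔ y ∈ Ioo 0 x := by
      simp only [hI, mem_Ioo]; constructor <;> rintro ⟨h1, h2⟩ <;> constructor <;> linarith
    by_cases hy : y ∈ Ioo 0 x
    · simp [hiff.2 hy, indicator_of_mem hy]
    · simp [mt hiff.1 hy, indicator_of_notMem hy]
  have hright : ∀ (p q : ℝ → ℝ), (I.indicator p ⋆[ContinuousLinearMap.mul ℝ ℝ] q) x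
      = ∫ τ in (0 : ℝ)..x, p τ * q (x - τ) := fun p q => by
    rw [convolution_def, intervalIntegral.integral_of_le hx, integral_Ioc_eq_integral_Ioo,
      ← integral_indicator measurableSet_Ioo]
    refine integral_congr_ae (Eventually.of_forall fun y => ?_)
    by_cases hy : y ∈ Ioo 0 x
    · have hyI : y ∈ I := hy
      simp [hyI, indicator_of_mem hy]
    · have hyI : y ∉ I := hy
      simp [hyI, indicator_of_notMem hy]
  have hassoc := convolution_assoc (ContinuousLinearMap.mul ℝ ℝ) (ContinuousLinearMap.mul ℝ ℝ)
    (ContinuousLinearMap.mul ℝ ℝ) (ContinuousLinearMap.mul ℝ ℝ) (fun a b c => mul_assoc a b c)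
    (x₀ := x) hf'.aestronglyMeasurable hg'.aestronglyMeasurable hk'.aestronglyMeasurable
    (hf'.ae_convolution_exists _ hg') (hg'.norm.ae_convolution_exists _ hk'.norm) (by
      have hint : Integrable fun t => ((fun u => ‖I.indicator g u‖)
          ⋆[ContinuousLinearMap.mul ℝ ℝ] fun u => ‖I.indicator k u‖) (x - t) :=
        (hg'.norm.integrable_convolution _ hk'.norm).comp_sub_left x
      refine hint.bdd_mul (c := M) hf'.norm.aestronglyMeasurable
        (Eventually.of_forall fun t => ?_)
      rw [norm_norm]
      by_cases ht : t ∈ I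
      · rw [indicator_of_mem ht]; exact hM t (Ioo_subset_Icc_self ht)
      · rw [indicator_of_notMem ht, norm_zero]; exact hM0)
  rw [hleft, hright] at hassoc
  have h1 : ∀ y ∈ uIcc 0 x, (∫ τ in (0 : ℝ)..y, f τ * g (y - τ)) * k (x - y)
      = (I.indicator f ⋆[ContinuousLinearMap.mul ℝ ℝ] I.indicator g) y * k (x - y) :=
    fun y hy => by
      rw [uIcc_of_le hx] at hy
      rw [hconv f g y hy.1 hy.2]
  have h2 : ∀ τ ∈ uIcc 0 x, f τ * ∫ u in (0 : ℝ)..(x - τ), g u * k (x - τ - u)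
      = f τ * (I.indicator g ⋆[ContinuousLinearMap.mul ℝ ℝ] I.indicator k) (x - τ) :=
    fun τ hτ => by
      rw [uIcc_of_le hx] at hτ
      rw [hconv g k (x - τ) (by linarith [hτ.2]) (by linarith [hτ.1])]
  rw [intervalIntegral.integral_congr h1, intervalIntegral.integral_congr h2, hassoc]

/-- The Beta integral over `[0, a]` does not depend on `a`, as the exponents add up to `-1`. -/
lemma integral_rpow_mul_rpow_eq_beta {α : ℝ} (hα₀ : 0 < α) (hα₁ : α < 1) {a : ℝ} (ha : 0 < a) :
    ∫ u in (0 : ℝ)..a, u ^ (-α) * (a - u) ^ (α - 1) = ProbabilityTheory.beta (1 - α) α := by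
  have h := Complex.betaIntegral_scaled ((1 - α : ℝ) : ℂ) (α : ℂ) ha
  have h2 : ((a : ℂ)) ^ (((1 - α : ℝ) : ℂ) + (α : ℂ) - 1) = 1 := by
    have : (((1 - α : ℝ) : ℂ) + (α : ℂ) - 1) = 0 := by push_cast; ring
    rw [this, Complex.cpow_zero]
  rw [h2, one_mul] at h
  rw [ProbabilityTheory.beta_eq_betaIntegralReal _ _ (by linarith) hα₀, ← h]
  have h3 : ∫ x in (0 : ℝ)..a, (x : ℂ) ^ ((((1 - α : ℝ) : ℂ)) - 1) * ((a : ℂ) - x) ^ ((α : ℂ) - 1)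
      = ∫ x in (0 : ℝ)..a, ((x ^ (-α) * (a - x) ^ (α - 1) : ℝ) : ℂ) := by
    refine intervalIntegral.integral_congr fun x hx => ?_
    rw [uIcc_of_le ha.le] at hx
    rw [Complex.ofReal_mul, Complex.ofReal_cpow hx.1, Complex.ofReal_cpow (by linarith [hx.2])]
    push_cast
    ring_nf
  rw [h3, intervalIntegral.integral_ofReal, Complex.ofReal_re]

/-- Fractional integration of order `α` inverts Abel's equation `I^{1-α} f = I^1 h`, turning it into
`I^1 f = I^{1+α} h` (here without the Gamma factors). -/
lemma beta_mul_integral_eq_of_abel {α : ℝ} (hα₀ : 0 < α) (hα₁ : α < 1) {x : ℝ} (hx : 0 ≤ x)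
    {f h : ℝ → ℝ} (hf : ContinuousOn f (Icc 0 x)) (hh : ContinuousOn h (Icc 0 x))
    (heq : ∀ y ∈ Icc 0 x,
      ∫ τ in (0 : ℝ)..y, (y - τ) ^ (-α) * f τ = ∫ τ in (0 : ℝ)..y, h τ) :
    ProbabilityTheory.beta (1 - α) α * ∫ τ in (0 : ℝ)..x, f τ
      = 1 / α * ∫ τ in (0 : ℝ)..x, (x - τ) ^ α * h τ := by
  have hk : IntervalIntegrable (fun u : ℝ => u ^ (α - 1)) volume 0 x :=
    intervalIntegral.intervalIntegrable_rpow' (by linarith)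
  have h1 := integral_convolution_assoc hx hf
    (intervalIntegral.intervalIntegrable_rpow' (r := -α) (by linarith)) hk
  have h2 := integral_convolution_assoc (g := fun _ => 1) hx hh
    intervalIntegrable_const hk
  have h3 : ∫ y in (0 : ℝ)..x, (∫ τ in (0 : ℝ)..y, f τ * (y - τ) ^ (-α)) * (x - y) ^ (α - 1)
      = ∫ y in (0 : ℝ)..x, (∫ τ in (0 : ℝ)..y, h τ * 1) * (x - y) ^ (α - 1) := by
    refine intervalIntegral.integral_congr fun y hy => ?_
    rw [uIcc_of_le hx] at hy
    simp only [mul_one]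
    rw [← heq y hy]
    simp only [mul_comm (f _)]
  have h4 : ∫ τ in (0 : ℝ)..x, f τ * ∫ u in (0 : ℝ)..(x - τ), u ^ (-α) * (x - τ - u) ^ (α - 1)
      = ProbabilityTheory.beta (1 - α) α * ∫ τ in (0 : ℝ)..x, f τ := by
    rw [← intervalIntegral.integral_const_mul, intervalIntegral.integral_of_le hx,
      intervalIntegral.integral_of_le hx, integral_Ioc_eq_integral_Ioo,
      integral_Ioc_eq_integral_Ioo]
    refine setIntegral_congr_fun measurableSet_Ioo fun τ hτ => ?_
    rw [integral_rpow_mul_rpow_eq_beta hα₀ hα₁ (by linarith [hτ.2]), mul_comm]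
  have h5 : ∫ τ in (0 : ℝ)..x, h τ * ∫ u in (0 : ℝ)..(x - τ), 1 * (x - τ - u) ^ (α - 1)
      = 1 / α * ∫ τ in (0 : ℝ)..x, (x - τ) ^ α * h τ := by
    rw [← intervalIntegral.integral_const_mul]
    refine intervalIntegral.integral_congr fun τ _ => ?_
    simp only [one_mul]
    rw [intervalIntegral.integral_comp_sub_left (fun u : ℝ => u ^ (α - 1)), sub_self, sub_zero,
      integral_rpow (Or.inl (by linarith)), sub_add_cancel, Real.zero_rpow hα₀.ne']
    ring
  rw [← h4, ← h5, ← h1, ← h2, h3]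

end Abel

/-! ### Differentiation of integrals depending on time -/

/-- `f y t` is bounded for `y ∈ [0, L]`, locally uniformly in `t > 0`. -/
def LocallyBoundedInTime (L : ℝ) (f : ℝ → ℝ → ℝ) : Prop :=
  ∀ t₀ > 0, ∃ M, ∀ᶠ t in 𝓝 t₀, ∀ y ∈ Icc 0 L, |f y t| ≤ M

lemma LocallyBoundedInTime.of_continuousOn {L : ℝ} {f : ℝ → ℝ → ℝ}
    (hf : ContinuousOn (fun p : ℝ × ℝ => f p.1 p.2) (Icc 0 L ×ˢ Ioi 0)) :
    LocallyBoundedInTime L f := fun t₀ ht₀ => by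
  have hsub : Icc 0 L ×ˢ Icc (t₀ / 2) (2 * t₀) ⊆ Icc 0 L ×ˢ Ioi 0 :=
    prod_mono subset_rfl fun t ht => lt_of_lt_of_le (half_pos ht₀) ht.1
  obtain ⟨M, hM⟩ := (isCompact_Icc.prod isCompact_Icc).exists_bound_of_continuousOn (hf.mono hsub)
  refine ⟨M, ?_⟩
  filter_upwards [Icc_mem_nhds (half_lt_self ht₀) (by linarith : t₀ < 2 * t₀)] with t ht y hy
  exact hM (y, t) ⟨hy, ht⟩

lemma LocallyBoundedInTime.of_hasDerivAt {L : ℝ} {f f' : ℝ → ℝ → ℝ}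
    (hcont : ∀ t > 0, ContinuousOn (fun y => f y t) (Icc 0 L))
    (hderiv : ∀ y ∈ Icc 0 L, ∀ t > 0, HasDerivAt (fun s => f y s) (f' y t) t)
    (hbdd : LocallyBoundedInTime L f') : LocallyBoundedInTime L f := fun t₀ ht₀ => by
  obtain ⟨M, hM⟩ := hbdd t₀ ht₀
  obtain ⟨N, hN⟩ := isCompact_Icc.exists_bound_of_continuousOn (hcont t₀ ht₀)
  obtain ⟨ε, hε, hball⟩ := Metric.eventually_nhds_iff_ball.1 (hM.and (lt_mem_nhds ht₀))
  refine ⟨N + M * ε, ?_⟩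
  filter_upwards [Metric.ball_mem_nhds t₀ hε] with t ht y hy
  have hM0 : 0 ≤ M := (abs_nonneg _).trans ((hball t ht).1 y hy)
  have h1 := Convex.norm_image_sub_le_of_norm_hasDerivWithin_le
    (fun s hs => (hderiv y hy s (hball s hs).2).hasDerivWithinAt)
    (fun s hs => (hball s hs).1 y hy) (convex_ball t₀ ε) (Metric.mem_ball_self hε) ht
  have h2 : ‖t - t₀‖ ≤ ε := (mem_ball_iff_norm.1 ht).le
  have h3 : ‖f y t‖ ≤ ‖f y t₀‖ + ‖f y t - f y t₀‖ := by
    simpa using norm_add_le (f y t₀) (f y t - f y t₀)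
  have h4 := hN y hy
  have h5 := mul_le_mul_of_nonneg_left h2 hM0
  rw [← Real.norm_eq_abs]
  linarith

lemma hasDerivAt_integral_of_locallyBoundedInTime {L : ℝ} (hL : 0 ≤ L) {f f' : ℝ → ℝ → ℝ}
    (hcont : ∀ t > 0, ContinuousOn (fun y => f y t) (Icc 0 L))
    (hcont' : ∀ t > 0, ContinuousOn (fun y => f' y t) (Icc 0 L))
    (hderiv : ∀ y ∈ Icc 0 L, ∀ t > 0, HasDerivAt (fun s => f y s) (f' y t) t)
    (hbdd : LocallyBoundedInTime L f') {t : ℝ} (ht : 0 < t) :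
    HasDerivAt (fun s => ∫ y in (0 : ℝ)..L, f y s) (∫ y in (0 : ℝ)..L, f' y t) t := by
  obtain ⟨M, hM⟩ := hbdd t ht
  have hsub : uIoc 0 L ⊆ Icc 0 L := by rw [uIoc_of_le hL]; exact Ioc_subset_Icc_self
  have hmeas : ∀ {g : ℝ → ℝ}, ContinuousOn g (Icc 0 L) →
      AEStronglyMeasurable g (volume.restrict (uIoc 0 L)) := fun hg =>
    (hg.mono hsub).aestronglyMeasurable measurableSet_uIoc
  refine (intervalIntegral.hasDerivAt_integral_of_dominated_loc_of_deriv_le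
    (F := fun s y => f y s) (F' := fun s y => f' y s) (bound := fun _ => M)
    (hM.and (lt_mem_nhds ht)) ?_ ((hcont t ht).intervalIntegrable_of_Icc hL) (hmeas (hcont' t ht))
    (Eventually.of_forall fun y hy s hs => hs.1 y (hsub hy)) intervalIntegrable_const
    (Eventually.of_forall fun y hy s hs => hderiv y (hsub hy) s hs.2)).2
  filter_upwards [lt_mem_nhds ht] with s hs
  exact hmeas (hcont s hs)

/-! ### The Green function of `∂ₓ ᶜD^α` -/

/-- The kernel `(x - y)₊ ^ α - (L - y) ^ α`. Up to the factor `Γ(1 + α)` it is the Green function of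
`∂ₓ ᶜD^α` on `[0, L]` for the boundary conditions `f' 0 = 0` and `f L = 0`. -/
noncomputable def greenKernel (α L x y : ℝ) : ℝ := max (x - y) 0 ^ α - (L - y) ^ α

lemma continuous_greenKernel {α : ℝ} (hα : 0 < α) (L : ℝ) :
    Continuous fun p : ℝ × ℝ => greenKernel α L p.1 p.2 := by
  unfold greenKernel
  exact ((by fun_prop : Continuous fun p : ℝ × ℝ => max (p.1 - p.2) 0).rpow_const
    fun _ => Or.inr hα.le).sub ((by fun_prop : Continuous fun p : ℝ × ℝ => L - p.2).rpow_const
    fun _ => Or.inr hα.le)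

lemma abs_greenKernel_le {α : ℝ} (hα : 0 < α) {L x y : ℝ} (hx : x ∈ Icc 0 L) (hy : y ∈ Icc 0 L) :
    |greenKernel α L x y| ≤ L ^ α := by
  have hL : 0 ≤ L := hx.1.trans hx.2
  have h1 : 0 ≤ max (x - y) 0 ^ α := Real.rpow_nonneg (le_max_right _ _) _
  have h2 : max (x - y) 0 ^ α ≤ L ^ α :=
    Real.rpow_le_rpow (le_max_right _ _) (max_le (by linarith [hx.2, hy.1]) hL) hα.le
  have h3 : 0 ≤ (L - y) ^ α := Real.rpow_nonneg (by linarith [hy.2]) _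
  have h4 : (L - y) ^ α ≤ L ^ α :=
    Real.rpow_le_rpow (by linarith [hy.2]) (by linarith [hy.1]) hα.le
  unfold greenKernel
  rw [abs_le]; constructor <;> linarith

lemma continuous_integral_greenKernel {α : ℝ} (hα : 0 < α) {L : ℝ} (hL : 0 ≤ L) {f : ℝ → ℝ}
    (hf : ContinuousOn f (Icc 0 L)) :
    Continuous fun x => ∫ y in (0 : ℝ)..L, greenKernel α L x y * f y := by
  have hg : Continuous (IccExtend hL ((Icc 0 L).domRestrict f)) :=
    (continuousOn_iff_continuous_domRestrict.1 hf).Icc_extend'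
  have h := intervalIntegral.continuous_parametric_intervalIntegral_of_continuous' (μ := volume)
    (f := fun x y => greenKernel α L x y * IccExtend hL ((Icc 0 L).domRestrict f) y)
    ((continuous_greenKernel hα L).mul (hg.comp continuous_snd)) 0 L
  refine h.congr fun x => intervalIntegral.integral_congr fun y hy => ?_
  rw [uIcc_of_le hL] at hy
  simp only [IccExtend_of_mem hL _ hy, domRestrict_apply]

lemma abs_integral_greenKernel_le {α : ℝ} (hα : 0 < α) {L : ℝ} {f : ℝ → ℝ}
    (hf : ContinuousOn f (Icc 0 L)) {x : ℝ} (hx : x ∈ Icc 0 L) :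
    |∫ y in (0 : ℝ)..L, greenKernel α L x y * f y| ≤ L ^ α * ∫ y in (0 : ℝ)..L, |f y| := by
  have hL : 0 ≤ L := hx.1.trans hx.2
  rw [← intervalIntegral.integral_const_mul, ← Real.norm_eq_abs]
  refine intervalIntegral.norm_integral_le_of_norm_le hL ?_
    ((hf.abs.intervalIntegrable_of_Icc hL).const_mul _)
  refine Eventually.of_forall fun y hy => ?_
  rw [norm_mul]
  exact mul_le_mul_of_nonneg_right (abs_greenKernel_le hα hx ⟨hy.1.le, hy.2⟩) (norm_nonneg _)

lemma integral_greenKernel_eq {α : ℝ} (hα : 0 < α) {L x : ℝ} (hx : x ∈ Icc 0 L) {h : ℝ → ℝ}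
    (hh : ContinuousOn h (Icc 0 L)) :
    ∫ y in (0 : ℝ)..L, greenKernel α L x y * h y
      = (∫ y in (0 : ℝ)..x, (x - y) ^ α * h y) - ∫ y in (0 : ℝ)..L, (L - y) ^ α * h y := by
  have hL : 0 ≤ L := hx.1.trans hx.2
  have hpow : ∀ {g : ℝ → ℝ}, Continuous g → Continuous fun y => g y ^ α := fun hg =>
    hg.rpow_const fun _ => Or.inr hα.le
  have hint : ∀ {g : ℝ → ℝ}, Continuous g → ∀ {a b : ℝ}, 0 ≤ a → a ≤ b → b ≤ L →
      IntervalIntegrable (fun y => g y ^ α * h y) volume a b := fun hg a b ha hab hb =>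
    ((hpow hg).continuousOn.mul (hh.mono (Icc_subset_Icc ha hb))).intervalIntegrable_of_Icc hab
  have hmax : Continuous fun y => max (x - y) 0 := by fun_prop
  have h1 := intervalIntegral.integral_add_adjacent_intervals
    (hint hmax le_rfl hx.1 hx.2) (hint hmax hx.1 hx.2 le_rfl)
  have h2 : ∫ y in (0 : ℝ)..x, max (x - y) 0 ^ α * h y = ∫ y in (0 : ℝ)..x, (x - y) ^ α * h y := by
    refine intervalIntegral.integral_congr fun y hy => ?_
    rw [uIcc_of_le hx.1] at hy
    simp only [max_eq_left (by linarith [hy.2] : 0 ≤ x - y)]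
  have h3 : ∫ y in x..L, max (x - y) 0 ^ α * h y = 0 := by
    rw [intervalIntegral.integral_congr (g := fun _ => 0), intervalIntegral.integral_zero]
    intro y hy
    rw [uIcc_of_le hx.2] at hy
    simp only [max_eq_right (by linarith [hy.1] : x - y ≤ 0), Real.zero_rpow hα.ne', zero_mul]
  simp only [greenKernel, sub_mul]
  rw [intervalIntegral.integral_sub (hint hmax le_rfl hL le_rfl)
    (hint (by fun_prop) le_rfl hL le_rfl), ← h1, h2, h3, add_zero]

/-! ### Uniqueness for the integrated equation -/

/-- Uniqueness for the equation in the integrated form `c(t) D = ∫ G(x, y) ∂ₜD(y, t) dy`. The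
function `V = ∫ G D` satisfies `∂ₜV = c D`, so `∫ V²` does not increase by dissipativity of `G`, and
it tends to `0` as `t → 0` because `G` maps `L¹` boundedly into `L^∞`. -/
lemma eq_zero_of_integrated_equation {α : ℝ} (hα₀ : 0 < α) (hα₁ : α ≤ 1) {L : ℝ} (hL : 0 < L)
    {D D' : ℝ → ℝ → ℝ} {c : ℝ → ℝ} (hc : ∀ t > 0, 0 < c t)
    (hD : ∀ t > 0, ContinuousOn (fun x => D x t) (Icc 0 L))
    (hderiv : ∀ x ∈ Icc 0 L, ∀ t > 0, HasDerivAt (fun s => D x s) (D' x t) t)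
    (hD' : ContinuousOn (fun p : ℝ × ℝ => D' p.1 p.2) (Icc 0 L ×ˢ Ioi 0))
    (heq : ∀ t > 0, ∀ x ∈ Icc 0 L,
      c t * D x t = ∫ y in (0 : ℝ)..L, greenKernel α L x y * D' y t)
    (hlim : Tendsto (fun t => ∫ x in (0 : ℝ)..L, |D x t|) (𝓝[>] 0) (𝓝 0)) :
    ∀ t > 0, ∀ x ∈ Icc 0 L, D x t = 0 := by
  have hD'bdd : LocallyBoundedInTime L D' := .of_continuousOn hD'
  have hD'cont : ∀ t > 0, ContinuousOn (fun y => D' y t) (Icc 0 L) := fun t ht =>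
    hD'.comp (f := fun y => (y, t)) (by fun_prop) fun y hy => ⟨hy, ht⟩
  have hGcont : ∀ x, Continuous (greenKernel α L x) := fun x =>
    (continuous_greenKernel hα₀ L).comp (by fun_prop : Continuous fun y : ℝ => (x, y))
  set V : ℝ → ℝ → ℝ := fun x t => ∫ y in (0 : ℝ)..L, greenKernel α L x y * D y t with hV
  have hGbdd : ∀ x ∈ Icc 0 L, LocallyBoundedInTime L fun y t => greenKernel α L x y * D' y t :=
    fun x hx t ht => by
      obtain ⟨M, hM⟩ := hD'bdd t ht
      refine ⟨L ^ α * M, hM.mono fun s hs y hy => ?_⟩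
      rw [abs_mul]
      exact mul_le_mul (abs_greenKernel_le hα₀ hx hy) (hs y hy) (abs_nonneg _)
        (Real.rpow_nonneg hL.le _)
  have hVderiv : ∀ x ∈ Icc 0 L, ∀ t > 0, HasDerivAt (fun s => V x s) (c t * D x t) t :=
    fun x hx t ht => by
      rw [heq t ht x hx]
      exact hasDerivAt_integral_of_locallyBoundedInTime hL.le
        (fun s hs => (hGcont x).continuousOn.mul (hD s hs))
        (fun s hs => (hGcont x).continuousOn.mul (hD'cont s hs))
        (fun y hy s hs => (hderiv y hy s hs).const_mul _) (hGbdd x hx) ht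
  have hVcont : ∀ t > 0, Continuous fun x => V x t := fun t ht =>
    continuous_integral_greenKernel hα₀ hL.le (hD t ht)
  -- The bound comes from the integral form of `c D`: the factor `c` alone may be unbounded near `t`.
  have hV'bdd : LocallyBoundedInTime L fun x t => c t * D x t := fun t ht => by
    obtain ⟨M, hM⟩ := hD'bdd t ht
    refine ⟨L ^ α * (M * L), ?_⟩
    filter_upwards [hM, lt_mem_nhds ht] with s hs hs0 x hx
    have h1 : ∫ y in (0 : ℝ)..L, |D' y s| ≤ M * L := by
      have := intervalIntegral.integral_mono_on (μ := volume) hL.le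
        ((hD'cont s hs0).abs.intervalIntegrable_of_Icc hL.le)
        (intervalIntegrable_const (c := M)) hs
      simpa [mul_comm] using this
    rw [heq s hs0 x hx]
    exact (abs_integral_greenKernel_le hα₀ (hD'cont s hs0) hx).trans
      (mul_le_mul_of_nonneg_left h1 (Real.rpow_nonneg hL.le _))
  have hVbdd : LocallyBoundedInTime L V :=
    .of_hasDerivAt (fun t ht => (hVcont t ht).continuousOn) hVderiv hV'bdd
  set E : ℝ → ℝ := fun t => ∫ x in (0 : ℝ)..L, V x t ^ 2 with hE
  have hEderiv : ∀ t > 0, HasDerivAt E (∫ x in (0 : ℝ)..L, 2 * V x t * (c t * D x t)) t :=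
    fun t ht => by
      refine hasDerivAt_integral_of_locallyBoundedInTime hL.le
        (f' := fun x t => 2 * V x t * (c t * D x t))
        (fun s hs => ((hVcont s hs).pow 2).continuousOn)
        (fun s hs => ((hVcont s hs).continuousOn.const_mul 2).mul ((hD s hs).const_mul (c s)))
        (fun x hx s hs => ?_) (fun s hs => ?_) ht
      · exact ((hVderiv x hx s hs).pow 2).congr_deriv (by simp)
      · obtain ⟨M, hM⟩ := hVbdd s hs
        obtain ⟨N, hN⟩ := hV'bdd s hs
        refine ⟨2 * M * N, ?_⟩
        filter_upwards [hM, hN] with r hr hr' x hx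
        have h1 := hr x hx
        have h2 := hr' x hx
        rw [abs_mul, abs_mul 2, abs_two]
        have h3 := (abs_nonneg _).trans h1
        gcongr
  have hEnonpos : ∀ t > 0, ∫ x in (0 : ℝ)..L, 2 * V x t * (c t * D x t) ≤ 0 := fun t ht => by
    have h := rpowKernel_quadratic_nonpos hα₀ hα₁ hL.le (hD t ht)
    have h2 : ∫ x in (0 : ℝ)..L, 2 * V x t * (c t * D x t)
        = 2 * c t * ∫ x in (0 : ℝ)..L, D x t * V x t := by
      rw [← intervalIntegral.integral_const_mul]
      exact intervalIntegral.integral_congr fun x _ => by ring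
    rw [h2]
    exact mul_nonpos_of_nonneg_of_nonpos (by linarith [hc t ht]) h
  have hEanti : AntitoneOn E (Ioi 0) := by
    refine antitoneOn_of_deriv_nonpos (convex_Ioi 0)
      (fun t ht => (hEderiv t ht).continuousAt.continuousWithinAt) ?_ ?_
    · rw [interior_Ioi]
      exact fun t ht => (hEderiv t ht).differentiableAt.differentiableWithinAt
    · rw [interior_Ioi]
      exact fun t ht => (hEderiv t ht).deriv ▸ hEnonpos t ht
  have hEle : ∀ t > 0, E t ≤ L * (L ^ α * ∫ x in (0 : ℝ)..L, |D x t|) ^ 2 := fun t ht => by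
    have := intervalIntegral.integral_mono_on (μ := volume) hL.le
      (((hVcont t ht).pow 2).intervalIntegrable 0 L)
      (intervalIntegrable_const (c := (L ^ α * ∫ x in (0 : ℝ)..L, |D x t|) ^ 2))
      fun x hx => sq_le_sq' (neg_le_of_abs_le (abs_integral_greenKernel_le hα₀ (hD t ht) hx))
        (le_of_abs_le (abs_integral_greenKernel_le hα₀ (hD t ht) hx))
    simpa using this
  have hElim : Tendsto (fun t => L * (L ^ α * ∫ x in (0 : ℝ)..L, |D x t|) ^ 2) (𝓝[>] 0) (𝓝 0) := by
    simpa using ((hlim.const_mul (L ^ α)).pow 2).const_mul L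
  have hE0 : ∀ t > 0, E t ≤ 0 := fun t ht => by
    refine ge_of_tendsto hElim ?_
    filter_upwards [Ioo_mem_nhdsGT ht] with s hs
    exact (hEanti hs.1 ht hs.2.le).trans (hEle s hs.1)
  have hV0 : ∀ t > 0, ∀ x ∈ Icc 0 L, V x t = 0 := fun t ht x hx => by
    by_contra hne
    have hpos := intervalIntegral.integral_pos hL ((hVcont t ht).pow 2).continuousOn
      (fun x _ => sq_nonneg (V x t)) ⟨x, hx, (sq_pos_of_ne_zero hne : 0 < V x t ^ 2)⟩
    exact absurd (hE0 t ht) (not_le.2 hpos)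
  intro t ht x hx
  have h1 : HasDerivAt (fun s => V x s) 0 t :=
    (hasDerivAt_const t (0 : ℝ)).congr_of_eventuallyEq
      ((lt_mem_nhds ht).mono fun s hs => hV0 s hs x hx)
  have h2 := (hVderiv x hx t ht).unique h1
  exact (mul_eq_zero.1 h2).resolve_left (hc t ht).ne'

/-! ### Inversion of the Caputo derivative -/

lemma caputoDeriv_one (a b : ℝ) (f : ℝ → ℝ) (x : ℝ) :
    caputoDeriv 1 a b f x = derivWithin f (Icc a b) x := by
  simp [caputoDeriv, iteratedDerivWithin_one]

lemma caputoDeriv_of_lt_one {α : ℝ} (hα₀ : 0 < α) (hα₁ : α < 1) (a b : ℝ) (f : ℝ → ℝ) (x : ℝ) :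
    caputoDeriv α a b f x = 1 / Real.Gamma (1 - α) *
      ∫ τ in a..x, (x - τ) ^ (-α) * derivWithin f (Icc a b) τ := by
  have hceil : ⌈α⌉₊ = 1 := by
    rw [Nat.ceil_eq_iff one_ne_zero]
    simpa using ⟨hα₀, hα₁.le⟩
  have hexp : (1 : ℝ) - α - 1 = -α := by ring
  simp only [caputoDeriv, hceil, Nat.cast_one, if_neg hα₁.ne, iteratedDerivWithin_one, hexp]

lemma integral_derivWithin_Icc_eq_sub {L x : ℝ} (hx : x ∈ Icc 0 L) {f : ℝ → ℝ}
    (hf : ContDiffOn ℝ 1 f (Icc 0 L)) :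
    ∫ τ in (0 : ℝ)..x, derivWithin f (Icc 0 L) τ = f x - f 0 := by
  rcases hx.1.eq_or_lt with rfl | hx0
  · simp
  have hsub : Icc 0 x ⊆ Icc 0 L := Icc_subset_Icc_right hx.2
  have hcont : ContinuousOn (derivWithin f (Icc 0 L)) (Icc 0 x) :=
    (hf.continuousOn_derivWithin (uniqueDiffOn_Icc (hx0.trans_le hx.2)) le_rfl).mono hsub
  refine intervalIntegral.integral_eq_sub_of_hasDerivAt_of_le hx.1 (hf.continuousOn.mono hsub)
    (fun τ hτ => ?_) (hcont.intervalIntegrable_of_Icc hx.1)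
  exact ((hf.differentiableOn one_ne_zero) τ
    (hsub (Ioo_subset_Icc_self hτ))).hasDerivWithinAt.hasDerivAt
    (Icc_mem_nhds hτ.1 (hτ.2.trans_le hx.2))

/-- Recovering a function from its Caputo derivative: if the Caputo derivatives of two functions
differ by `I^1 h`, then the functions differ by `I^{1+α} h`, up to an additive constant. -/
lemma exists_sub_eq_of_caputoDeriv_sub_eq {α : ℝ} (hα₀ : 0 < α) (hα₁ : α ≤ 1) {L : ℝ}
    (hL : 0 < L) :
    ∃ κ > 0, ∀ f₁ f₂ h : ℝ → ℝ, ContDiffOn ℝ 1 f₁ (Icc 0 L) → ContDiffOn ℝ 1 f₂ (Icc 0 L) →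
      ContinuousOn h (Icc 0 L) →
      (∀ y ∈ Icc 0 L,
        caputoDeriv α 0 L f₁ y - caputoDeriv α 0 L f₂ y = ∫ τ in (0 : ℝ)..y, h τ) →
      ∀ x ∈ Icc 0 L, (f₁ x - f₂ x) - (f₁ 0 - f₂ 0)
        = κ * ∫ τ in (0 : ℝ)..x, (x - τ) ^ α * h τ := by
  have hcont : ∀ {f : ℝ → ℝ}, ContDiffOn ℝ 1 f (Icc 0 L) →
      ContinuousOn (derivWithin f (Icc 0 L)) (Icc 0 L) := fun hf =>
    hf.continuousOn_derivWithin (uniqueDiffOn_Icc hL) le_rfl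
  have hFTC : ∀ {f₁ f₂ : ℝ → ℝ}, ContDiffOn ℝ 1 f₁ (Icc 0 L) → ContDiffOn ℝ 1 f₂ (Icc 0 L) →
      ∀ x ∈ Icc 0 L, ∫ τ in (0 : ℝ)..x,
        (derivWithin f₁ (Icc 0 L) τ - derivWithin f₂ (Icc 0 L) τ)
          = (f₁ x - f₂ x) - (f₁ 0 - f₂ 0) := fun hf₁ hf₂ x hx => by
    have hsub : Icc 0 x ⊆ Icc 0 L := Icc_subset_Icc_right hx.2
    rw [intervalIntegral.integral_sub
      (((hcont hf₁).mono hsub).intervalIntegrable_of_Icc hx.1)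
      (((hcont hf₂).mono hsub).intervalIntegrable_of_Icc hx.1),
      integral_derivWithin_Icc_eq_sub hx hf₁, integral_derivWithin_Icc_eq_sub hx hf₂]
    ring
  rcases hα₁.eq_or_lt with rfl | hlt
  · refine ⟨1, one_pos, fun f₁ f₂ h hf₁ hf₂ hh heq x hx => ?_⟩
    have hsub : Icc 0 x ⊆ Icc 0 L := Icc_subset_Icc_right hx.2
    have h1 := integral_convolution_assoc (g := fun _ => 1) (k := fun _ => 1) hx.1 (hh.mono hsub)
      intervalIntegrable_const intervalIntegrable_const
    simp only [mul_one, intervalIntegral.integral_const, sub_zero, smul_eq_mul] at h1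
    simp only [caputoDeriv_one] at heq
    rw [← hFTC hf₁ hf₂ x hx, one_mul]
    simp only [Real.rpow_one, mul_comm (x - _)]
    rw [← h1]
    refine intervalIntegral.integral_congr fun y hy => ?_
    rw [uIcc_of_le hx.1] at hy
    exact heq y (hsub hy)
  · have hB := ProbabilityTheory.beta_pos (by linarith : 0 < 1 - α) hα₀
    have hΓ : 0 < Real.Gamma (1 - α) := Real.Gamma_pos_of_pos (by linarith)
    refine ⟨Real.Gamma (1 - α) / (α * ProbabilityTheory.beta (1 - α) α), by positivity,
      fun f₁ f₂ h hf₁ hf₂ hh heq x hx => ?_⟩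
    have hsub : Icc 0 x ⊆ Icc 0 L := Icc_subset_Icc_right hx.2
    have hint : ∀ {f : ℝ → ℝ}, ContDiffOn ℝ 1 f (Icc 0 L) → ∀ y ∈ Icc 0 L,
        IntervalIntegrable (fun τ => (y - τ) ^ (-α) * derivWithin f (Icc 0 L) τ) volume 0 y :=
      fun hf y hy => by
        have h1 : IntervalIntegrable (fun u : ℝ => u ^ (-α)) volume (y - 0) (y - y) :=
          intervalIntegral.intervalIntegrable_rpow' (by linarith)
        refine (by simpa using h1.comp_sub_left y :
          IntervalIntegrable (fun τ : ℝ => (y - τ) ^ (-α)) volume 0 y).mul_continuousOn ?_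
        rw [uIcc_of_le hy.1]
        exact (hcont hf).mono (Icc_subset_Icc_right hy.2)
    have habel := beta_mul_integral_eq_of_abel hα₀ hlt hx.1
      (f := fun τ => derivWithin f₁ (Icc 0 L) τ - derivWithin f₂ (Icc 0 L) τ)
      (h := fun τ => Real.Gamma (1 - α) * h τ)
      (((hcont hf₁).sub (hcont hf₂)).mono hsub) ((hh.mono hsub).const_mul _) (fun y hy => by
        have h1 := heq y (hsub hy)
        simp only [caputoDeriv_of_lt_one hα₀ hlt] at h1
        simp only [mul_sub]
        rw [intervalIntegral.integral_sub (hint hf₁ y (hsub hy)) (hint hf₂ y (hsub hy)),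
          intervalIntegral.integral_const_mul, ← h1]
        field_simp)
    rw [hFTC hf₁ hf₂ x hx] at habel
    simp only [mul_left_comm _ (Real.Gamma (1 - α))] at habel
    rw [intervalIntegral.integral_const_mul] at habel
    field_simp at habel ⊢
    linear_combination habel

/-! ### Solutions of the gas pressure system -/

namespace IsGasPressureSolution

variable {α L C μ ρ : ℝ} {k u g₀ : ℝ → ℝ} {Q Q₁ Q₂ P P₁ P₂ : ℝ → ℝ → ℝ}

/-- For `α = 1` this is the boundary condition `P_x(0, t) = 0`; for `α < 1` it holds for every
profile. -/
lemma caputoDeriv_zero (hα₀ : 0 < α) (hα₁ : α ≤ 1) (hL : 0 < L)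
    (hP : IsGasPressureSolution α L C μ ρ k u g₀ Q P) {t : ℝ} (ht : 0 < t) :
    caputoDeriv α 0 L (fun x => P x t) 0 = 0 := by
  rcases hα₁.eq_or_lt with rfl | hlt
  · rw [caputoDeriv_one]
    exact (hP.boundary_left t ht).derivWithin (uniqueDiffOn_Icc hL 0 ⟨le_rfl, hL.le⟩)
  · rw [caputoDeriv_of_lt_one hα₀ hlt, intervalIntegral.integral_same, mul_zero]

/-- The difference of the two equations, integrated in space from `0` to `y`. -/
lemma caputoDeriv_sub_caputoDeriv (hα₀ : 0 < α) (hα₁ : α ≤ 1) (hL : 0 < L)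
    (hC : 0 < C) (hμ : 0 < μ)
    (hP₁ : IsGasPressureSolution α L C μ ρ k u g₀ Q₁ P₁)
    (hP₂ : IsGasPressureSolution α L C μ ρ k u g₀ Q₂ P₂) {t : ℝ} (ht : 0 < t) (hk : 0 < k t)
    (hQ : ∀ᵐ x ∂(volume.restrict (Icc 0 L)), Q₁ x t = Q₂ x t) {y : ℝ} (hy : y ∈ Icc 0 L) :
    caputoDeriv α 0 L (fun x => P₁ x t) y - caputoDeriv α 0 L (fun x => P₂ x t) y
      = ∫ x in (0 : ℝ)..y, (deriv (fun s => P₁ x s) t - deriv (fun s => P₂ x s) t)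
          / (1 / C * (k t / μ)) := by
  have hsub : Icc 0 y ⊆ Icc 0 L := Icc_subset_Icc_right hy.2
  have hsub' : uIcc 0 y ⊆ uIcc 0 L := by
    rwa [uIcc_of_le hy.1, uIcc_of_le hL.le]
  have hac₁ := (hP₁.absolutelyContinuous_caputo t ht).mono hsub'
  have hac₂ := (hP₂.absolutelyContinuous_caputo t ht).mono hsub'
  have h1 := hac₁.integral_deriv_eq_sub
  have h2 := hac₂.integral_deriv_eq_sub
  rw [hP₁.caputoDeriv_zero hα₀ hα₁ hL ht, sub_zero] at h1
  rw [hP₂.caputoDeriv_zero hα₀ hα₁ hL ht, sub_zero] at h2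
  rw [← h1, ← h2, ← intervalIntegral.integral_sub hac₁.intervalIntegrable_deriv
    hac₂.intervalIntegrable_deriv, intervalIntegral.integral_of_le hy.1,
    intervalIntegral.integral_of_le hy.1]
  have hle : volume.restrict (Ioc 0 y) ≤ volume.restrict (Icc 0 L) :=
    Measure.restrict_mono_set _ (Ioc_subset_Icc_self.trans hsub)
  refine integral_congr_ae (ae_mono hle ?_)
  filter_upwards [hP₁.equation t ht, hP₂.equation t ht, hQ] with x h3 h4 h5
  rw [h5] at h3
  have hpos : 0 < 1 / C * (k t / μ) := by positivity
  rw [eq_div_iff hpos.ne']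
  linear_combination h4 - h3

lemma tendsto_integral_abs_sub (hL : 0 < L) (hg₀ : IntegrableOn g₀ (Icc 0 L) volume)
    (hP₁ : IsGasPressureSolution α L C μ ρ k u g₀ Q₁ P₁)
    (hP₂ : IsGasPressureSolution α L C μ ρ k u g₀ Q₂ P₂) :
    Tendsto (fun t => ∫ x in (0 : ℝ)..L, |P₁ x t - P₂ x t|) (𝓝[>] 0) (𝓝 0) := by
  have hg : IntervalIntegrable g₀ volume 0 L :=
    (intervalIntegrable_iff_integrableOn_Icc_of_le hL.le).2 hg₀
  have hsum := hP₁.initial_tendsto.add hP₂.initial_tendsto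
  rw [add_zero] at hsum
  refine squeeze_zero' (Eventually.of_forall fun t =>
    intervalIntegral.integral_nonneg hL.le fun x _ => abs_nonneg _) ?_ hsum
  filter_upwards [self_mem_nhdsWithin] with t ht
  have hi₁ := (hP₁.contDiffOn_space t ht).continuousOn.intervalIntegrable_of_Icc (μ := volume) hL.le
  have hi₂ := (hP₂.contDiffOn_space t ht).continuousOn.intervalIntegrable_of_Icc (μ := volume) hL.le
  rw [← intervalIntegral.integral_add (hi₁.sub hg).abs (hi₂.sub hg).abs]
  refine intervalIntegral.integral_mono_on hL.le (hi₁.sub hi₂).abs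
    ((hi₁.sub hg).abs.add (hi₂.sub hg).abs) fun x _ => ?_
  calc |P₁ x t - P₂ x t| = |(P₁ x t - g₀ x) - (P₂ x t - g₀ x)| := by ring_nf
    _ ≤ _ := abs_sub _ _

end IsGasPressureSolution

theorem mainTheorem2 (α L C μ ρ : ℝ) (hα₀ : 0 < α) (hα₁ : α ≤ 1) (hL : 0 < L)
    (hC : 0 < C) (hμ : 0 < μ) (hρ : 0 < ρ)
    (k : ℝ → ℝ) (hk : ∀ t > 0, 0 < k t)
    (g₀ : ℝ → ℝ) (hg₀ : IntegrableOn g₀ (Icc 0 L) volume)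
    (u : ℝ → ℝ) (hu : ContDiffOn ℝ 1 u (Ici 0))
    (Q₁ Q₂ : ℝ → ℝ → ℝ)
    (hQ₁ : ∀ t > 0, IntegrableOn (fun x => Q₁ x t) (Icc 0 L) volume)
    (hQ₂ : ∀ t > 0, IntegrableOn (fun x => Q₂ x t) (Icc 0 L) volume)
    (P₁ P₂ : ℝ → ℝ → ℝ)
    (hP₁ : IsGasPressureSolution α L C μ ρ k u g₀ Q₁ P₁)
    (hP₂ : IsGasPressureSolution α L C μ ρ k u g₀ Q₂ P₂)
    (hQ : ∀ t > 0, ∀ᵐ x ∂(volume.restrict (Icc 0 L)), Q₁ x t = Q₂ x t) :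
    ∀ t ≥ 0, ∀ x ∈ Icc 0 L, P₁ x t = P₂ x t := by
  obtain ⟨κ, hκ, hinv⟩ := exists_sub_eq_of_caputoDeriv_sub_eq hα₀ hα₁ hL
  set D' : ℝ → ℝ → ℝ := fun x t => deriv (fun s => P₁ x s) t - deriv (fun s => P₂ x s) t with hD'
  set a : ℝ → ℝ := fun t => 1 / C * (k t / μ) with ha
  have hapos : ∀ t > 0, 0 < a t := fun t ht => by have := hk t ht; positivity
  have hD'cont : ContinuousOn (fun p : ℝ × ℝ => D' p.1 p.2) (Icc 0 L ×ˢ Ioi 0) :=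
    hP₁.continuousOn_deriv_time.sub hP₂.continuousOn_deriv_time
  have hint : ∀ t > 0, ∀ x ∈ Icc 0 L, a t / κ * (P₁ x t - P₂ x t)
      = ∫ y in (0 : ℝ)..L, greenKernel α L x y * D' y t := fun t ht x hx => by
    have hcont : ContinuousOn (fun y => D' y t) (Icc 0 L) :=
      hD'cont.comp (f := fun y => (y, t)) (by fun_prop) fun y hy => ⟨hy, ht⟩
    have h1 := hinv (fun x => P₁ x t) (fun x => P₂ x t) (fun x => D' x t / a t)
      (hP₁.contDiffOn_space t ht) (hP₂.contDiffOn_space t ht) (hcont.div_const _)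
      fun y hy => hP₁.caputoDeriv_sub_caputoDeriv hα₀ hα₁ hL hC hμ hP₂ ht (hk t ht) (hQ t ht) hy
    -- `h1` determines `D` up to its value at `0`, which the condition at `x = L` eliminates.
    have h2 := h1 L ⟨hL.le, le_rfl⟩
    have h3 := h1 x hx
    simp only [hP₁.boundary_right t ht, hP₂.boundary_right t ht, ← mul_div_assoc,
      intervalIntegral.integral_div] at h2 h3
    rw [integral_greenKernel_eq hα₀ hx hcont]
    have hat := (hapos t ht).ne'
    have hκ' := hκ.ne'
    field_simp at h2 h3 ⊢
    linear_combination h3 - h2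
  intro t ht x hx
  rcases ht.eq_or_lt with rfl | ht
  · rw [hP₁.initial x hx, hP₂.initial x hx]
  · refine sub_eq_zero.1 (eq_zero_of_integrated_equation hα₀ hα₁ hL
      (D := fun x t => P₁ x t - P₂ x t) (D' := D') (c := fun t => a t / κ)
      (fun t ht => div_pos (hapos t ht) hκ)
      (fun t ht => (hP₁.contDiffOn_space t ht).continuousOn.sub
        (hP₂.contDiffOn_space t ht).continuousOn)
      (fun x hx t ht => (hP₁.differentiableAt_time x hx t ht).hasDerivAt.sub
        (hP₂.differentiableAt_time x hx t ht).hasDerivAt)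
      hD'cont hint (hP₁.tendsto_integral_abs_sub hL hg₀ hP₂) t ht x hx)
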